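/- **Setting.** Let $\mathbb{P}\subset\mathbb{R}^{n_p}$ be compact and convex, and consider the discrete-time linear parameter-varying system $x_{k+1}=A(p_k)x_k+B(p_k)u_k$ with $x_k\in\mathbb{R}^{n_x}$, $u_k\in\mathbb{R}^{n_u}$, $p_k\in\mathbb{P}$, $A(p)=A_0+\sum_{i=1}^{n_p}p_iA_i$, $B(p)=B_0+\sum_{i=1}^{n_p}p_iB_i$. Let $\{u^d_k,p^d_k,x^d_k\}_{k=1}^{N_d}$ be a trajectory of this system, put $X=[x^d_1\cdots x^d_{N_d-1}]$, $X_+=[x^d_2\cdots x^d_{N_d}]$, $U=[u^d_1\cdots u^d_{N_d-1}]$, $X^p=[p^d_1\otimes x^d_1\ \cdots\ p^d_{N_d-1}\otimes x^d_{N_d-1}]$, $U^p=[p^d_1\otimes u^d_1\ \cdots\ p^d_{N_d-1}\otimes u^d_{N_d-1}]$, and assume that $\mathcal{G}=\begin{bmatrix}X\\X^p\\U\\U^p\end{bmatrix}$ has full row rank $(1+n_p)(n_x+n_u)$. Let $Q\succeq0$ ($n_x\times n_x$), $R\succ0$ ($n_u\times n_u$) and $\gamma>0$; square roots are the positive semidefinite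 ones. For symmetric $P\in\mathbb{R}^{n_x\times n_x}$ and $F_Q\in\mathbb{R}^{(N_d-1)(1+n_p)\times n_x(1+n_p)}$ let $P_0=\mathrm{blkdiag}(P,0_{n_xn_p})$, $I_{n_{x0}}=\mathrm{blkdiag}(I_{n_x},0_{n_xn_p})$, $\mathcal{X}_+=\mathrm{blkdiag}(X_+,I_{n_p}\otimes X_+)$, $$W=\begin{bmatrix}P_0-I_{n_{x0}}&\mathcal{X}_+F_Q\\(\mathcal{X}_+F_Q)^\top&P_0\end{bmatrix},\qquad \Delta(p)=\mathrm{diag}(p)\otimes I_{2n_x},\qquad L_{11}=0_{2n_xn_p},\qquad L_{12}=1_{n_p}\otimes I_{2n_x},$$ $$L_{21}=\begin{bmatrix}0\\I_{n_p}\otimes[I_{n_x}\ 0]\\0\\I_{n_p}\otimes[0\ I_{n_x}]\end{bmatrix},\qquad L_{22}=\begin{bmatrix}[I_{n_x}\ 0]\\0\\ [0\ I_{n_x}]\\0\end{bmatrix},$$ where in $L_{21},L_{22}$ the block rows have heights $n_x,\,n_xn_p,\,n_x,\,n_xn_p$. **Theorem.** Suppose there are symmetric $P\in\mathbb{R}^{n_x\times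 n_x}$, $S\in\mathbb{R}^{n_u\times n_u}$, $\Xi\in\mathbb{R}^{4n_pn_x\times4n_pn_x}$, and matrices $Y_0\in\mathbb{R}^{n_u\times n_x}$, $\bar Y\in\mathbb{R}^{n_u\times n_xn_p}$, $\mathcal{Y}=[Y_0\ \bar Y]$, $\mathcal{F}\in\mathbb{R}^{(N_d-1)\times n_x(1+n_p+n_p^2)}$ and $F_Q$ such that, for all $p\in\mathbb{P}$, $$\mathcal{F}\begin{bmatrix}I_{n_x}\\p\otimes I_{n_x}\\p\otimes p\otimes I_{n_x}\end{bmatrix}=\begin{bmatrix}I_{N_d-1}\\p\otimes I_{N_d-1}\end{bmatrix}^\top F_Q\begin{bmatrix}I_{n_x}\\p\otimes I_{n_x}\end{bmatrix},$$ the coupling equality $$\begin{bmatrix}P&0&0\\0&I_{n_p}\otimes P&0\\Y_0&\bar Y&0\\0&I_{n_p}\otimes Y_0&I_{n_p}\otimes\bar Y\end{bmatrix}=\mathcal{G}\mathcal{F}$$ holds, the S-procedure LMIs $$\begin{bmatrix}L_{11}&L_{12}\\I&0\\L_{21}&L_{22}\end{bmatrix}^\top\begin{bmatrix}\Xi&0\\0&-W\end{bmatrix}\begin{bmatrix}L_{11}&L_{12}\\I&0\\L_{21}&L_{22}\end{bmatrix}\prec0,\qquad\begin{bmatrix}I\\\Delta(p)\end{bmatrix}^\top\Xi\begin{bmatrix}I\\\Delta(p)\end{bmatrix}\succeq0\quad\forall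 p\in\mathbb{P}$$ hold, and $$\begin{bmatrix}S&R^{1/2}\mathcal{Y}\begin{bmatrix}I_{n_x}\\p\otimes I_{n_x}\end{bmatrix}\\(*)^\top&P\end{bmatrix}\succ0\quad\forall p\in\mathbb{P},\qquad P-I_{n_x}\succ0,\qquad\mathrm{tr}(QP)+\mathrm{tr}(S)<\gamma^2 .$$ Put $K_0=Y_0P^{-1}$, $[K_1\cdots K_{n_p}]=\bar Y(I_{n_p}\otimes P)^{-1}$ and $K(p)=K_0+\sum_{i=1}^{n_p}p_iK_i$. Then the closed loop $x_{k+1}=(A(p_k)+B(p_k)K(p_k))x_k$ is asymptotically stable and exponentially stable under all scheduling trajectories in $\mathbb{P}$, uniformly in the scheduling trajectory. Moreover, for the closed-loop generalized plant $$x_{k+1}=(A(p_k)+B(p_k)K(p_k))x_k+w_k,\quad x_0=0,\qquad z_k=\begin{bmatrix}Q^{1/2}\\R^{1/2}K(p_k)\end{bmatrix}x_k,$$ where $w$ is white noise (square-integrable, zero mean, identity covariance, uncorrelated in time), the generalized $\mathcal{H}_2$ norm is less than $\gamma$: $$\sup_{p\in\mathbb{P}^{\mathbb{Z}}}\Big(\limsup_{N\to\infty}\mathbb{E}\Big[\tfrac1N\sum_{k=0}^Nz_k^\top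 z_k\Big]\Big)^{1/2}<\gamma .$$ -/

import Mathlib

open Matrix MeasureTheory Filter Topology
open scoped Kronecker MatrixOrder ENNReal

universe v

namespace LPV

/-! ### Block matrix conventions
A product index `Fin np × m` is the index set of a Kronecker product with first factor of size
`np`; a sum index `m ⊕ n` is the index set of a vertical or horizontal concatenation. -/

/-- `p ⊗ M` for a column vector `p ∈ ℝ^np` (for `M = I` this is `p ⊗ I`). -/
def colKron {np : ℕ} {m n : Type*} (p : Fin np → ℝ) (M : Matrix m n ℝ) :
    Matrix (Fin np × m) n ℝ :=
  Matrix.of fun i j => p i.1 * M i.2 j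

/-- The column `[I; p ⊗ I]`. -/
def regAff {np : ℕ} (m : Type*) [DecidableEq m] (p : Fin np → ℝ) :
    Matrix (m ⊕ Fin np × m) m ℝ :=
  fromRows (1 : Matrix m m ℝ) (colKron p (1 : Matrix m m ℝ))

/-- The column `[I; p ⊗ I; p ⊗ p ⊗ I]`. -/
def regQuad {np : ℕ} (m : Type*) [DecidableEq m] (p : Fin np → ℝ) :
    Matrix (m ⊕ (Fin np × m) ⊕ (Fin np × Fin np × m)) m ℝ :=
  fromRows (1 : Matrix m m ℝ)
    (fromRows (colKron p (1 : Matrix m m ℝ)) (colKron p (colKron p (1 : Matrix m m ℝ))))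

/-! ### The LPV system, the controller and the closed loop -/

/-- The coefficient matrices of an LPV state-space representation with affine dependence. -/
structure System (nx nu np : ℕ) where
  A₀ : Matrix (Fin nx) (Fin nx) ℝ
  A' : Fin np → Matrix (Fin nx) (Fin nx) ℝ
  B₀ : Matrix (Fin nx) (Fin nu) ℝ
  B' : Fin np → Matrix (Fin nx) (Fin nu) ℝ

/-- `A(p) = A₀ + ∑ pᵢ Aᵢ`. -/
def System.A {nx nu np : ℕ} (sys : System nx nu np) (p : Fin np → ℝ) :
    Matrix (Fin nx) (Fin nx) ℝ :=
  sys.A₀ + ∑ i, p i • sys.A' i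

/-- `B(p) = B₀ + ∑ pᵢ Bᵢ`. -/
def System.B {nx nu np : ℕ} (sys : System nx nu np) (p : Fin np → ℝ) :
    Matrix (Fin nx) (Fin nu) ℝ :=
  sys.B₀ + ∑ i, p i • sys.B' i

/-- The affine gain `K(p) = K₀ + ∑ pᵢ Kᵢ`, where `Kbar = [K₁ ⋯ K_np]`. -/
def gain {nx nu np : ℕ} (K₀ : Matrix (Fin nu) (Fin nx) ℝ)
    (Kbar : Matrix (Fin nu) (Fin np × Fin nx) ℝ) (p : Fin np → ℝ) :
    Matrix (Fin nu) (Fin nx) ℝ :=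
  K₀ + ∑ i, p i • Kbar.submatrix id (fun j => (i, j))

/-- `A_CL(p) = A(p) + B(p) K(p)`. -/
def System.closedLoop {nx nu np : ℕ} (sys : System nx nu np)
    (K : (Fin np → ℝ) → Matrix (Fin nu) (Fin nx) ℝ) (p : Fin np → ℝ) :
    Matrix (Fin nx) (Fin nx) ℝ :=
  sys.A p + sys.B p * K p

/-! ### Stability -/

/-- `(x, p)` solves `x_{k+1} = M(p_k) x_k` from time `k₀` on, with scheduling signal in `ℙ`. -/
def IsTrajectoryFrom {nx np : ℕ} (M : (Fin np → ℝ) → Matrix (Fin nx) (Fin nx) ℝ)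
    (ℙ : Set (Fin np → ℝ)) (k₀ : ℤ) (p : ℤ → Fin np → ℝ) (x : ℤ → Fin nx → ℝ) : Prop :=
  (∀ k, p k ∈ ℙ) ∧ ∀ k, k₀ ≤ k → x (k + 1) = M (p k) *ᵥ x k

/-- Asymptotic stability of `x_{k+1} = M(p_k) x_k` under all scheduling trajectories in `ℙ`:
stability in the sense of Lyapunov (uniformly in the scheduling and the initial time) and
convergence of all state trajectories to the origin. -/
def IsAsymptoticallyStable {nx np : ℕ} (M : (Fin np → ℝ) → Matrix (Fin nx) (Fin nx) ℝ)
    (ℙ : Set (Fin np → ℝ)) : Prop :=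
  (∀ ε : ℝ, 0 < ε → ∃ δ : ℝ, 0 < δ ∧ ∀ k₀ p x, IsTrajectoryFrom M ℙ k₀ p x →
      ‖WithLp.toLp 2 (x k₀)‖ < δ → ∀ k, k₀ ≤ k → ‖WithLp.toLp 2 (x k)‖ < ε) ∧
  ∀ k₀ p x, IsTrajectoryFrom M ℙ k₀ p x → Tendsto x atTop (𝓝 0)

/-- Exponential stability of `x_{k+1} = M(p_k) x_k`, uniformly over all scheduling trajectories
in `ℙ`. -/
def IsExponentiallyStable {nx np : ℕ} (M : (Fin np → ℝ) → Matrix (Fin nx) (Fin nx) ℝ)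
    (ℙ : Set (Fin np → ℝ)) : Prop :=
  ∃ C ρ : ℝ, 0 ≤ ρ ∧ ρ < 1 ∧ ∀ k₀ p x, IsTrajectoryFrom M ℙ k₀ p x →
    ∀ n : ℕ, ‖WithLp.toLp 2 (x (k₀ + n))‖ ≤ C * ρ ^ n * ‖WithLp.toLp 2 (x k₀)‖

/-! ### The generalized `H₂` norm -/

/-- White noise with identity covariance: square-integrable, zero-mean, uncorrelated in time. -/
structure IsWhiteNoise {Ω : Type*} [MeasurableSpace Ω] (μ : Measure Ω) {n : ℕ}
    (w : ℕ → Ω → Fin n → ℝ) : Prop where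
  memLp : ∀ k i, MemLp (fun ω => w k ω i) 2 μ
  mean : ∀ k i, ∫ ω, w k ω i ∂μ = 0
  cov : ∀ k l i j, ∫ ω, w k ω i * w l ω j ∂μ = if k = l ∧ i = j then 1 else 0

/-- The state of `x_{k+1} = M(p_k) x_k + w_k`, `x_0 = 0`. -/
def noisyState {Ω : Type*} {nx np : ℕ} (M : (Fin np → ℝ) → Matrix (Fin nx) (Fin nx) ℝ)
    (p : ℤ → Fin np → ℝ) (w : ℕ → Ω → Fin nx → ℝ) : ℕ → Ω → Fin nx → ℝ
  | 0 => fun _ => 0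
  | k + 1 => fun ω => M (p k) *ᵥ noisyState M p w k ω + w k ω

/-- The output matrix `C(p) = [Q^{1/2}; R^{1/2} K(p)]` of the closed-loop generalized plant, with
the positive semidefinite square roots. -/
noncomputable def perfMatrix {nx nu np : ℕ} (Q : Matrix (Fin nx) (Fin nx) ℝ)
    (R : Matrix (Fin nu) (Fin nu) ℝ) (K : (Fin np → ℝ) → Matrix (Fin nu) (Fin nx) ℝ)
    (p : Fin np → ℝ) : Matrix (Fin nx ⊕ Fin nu) (Fin nx) ℝ :=
  fromRows (CFC.sqrt Q) (CFC.sqrt R * K p)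

/-- The generalized `H₂` norm of `x_{k+1} = M(p_k) x_k + w_k`, `z_k = C(p_k) x_k`, for the noise
`w`: the supremum over all scheduling trajectories in `ℙ` of
`(limsup_N 𝔼[(1/N) ∑_{k=0}^N z_kᵀ z_k])^{1/2}`, as an extended nonnegative number. -/
noncomputable def genH2Norm {Ω : Type*} [MeasurableSpace Ω] (μ : Measure Ω) {nx np : ℕ}
    {nz : Type*} [Fintype nz] (M : (Fin np → ℝ) → Matrix (Fin nx) (Fin nx) ℝ)
    (C : (Fin np → ℝ) → Matrix nz (Fin nx) ℝ) (ℙ : Set (Fin np → ℝ))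
    (w : ℕ → Ω → Fin nx → ℝ) : ℝ≥0∞ :=
  ⨆ (p : ℤ → Fin np → ℝ) (_ : ∀ k, p k ∈ ℙ),
    (limsup (fun N : ℕ => ∫⁻ ω, ENNReal.ofReal ((1 / (N : ℝ)) * ∑ k ∈ Finset.range (N + 1),
      (C (p k) *ᵥ noisyState M p w k ω) ⬝ᵥ (C (p k) *ᵥ noisyState M p w k ω)) ∂μ) atTop)
      ^ (1 / 2 : ℝ)

/-! ### Data -/

/-- Data `{u_k, p_k, x_k}` with `N + 1` samples. -/
structure Data (nx nu np N : ℕ) where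
  u : Fin (N + 1) → Fin nu → ℝ
  p : Fin (N + 1) → Fin np → ℝ
  x : Fin (N + 1) → Fin nx → ℝ

/-- The data are a trajectory of the system. -/
def Data.IsTrajectoryOf {nx nu np N : ℕ} (d : Data nx nu np N) (sys : System nx nu np)
    (ℙ : Set (Fin np → ℝ)) : Prop :=
  (∀ k, d.p k ∈ ℙ) ∧ ∀ k : Fin N, d.x k.succ =
    sys.A (d.p k.castSucc) *ᵥ d.x k.castSucc + sys.B (d.p k.castSucc) *ᵥ d.u k.castSucc

/-- `X₊`: the states, without the first. -/
def Data.Xplus {nx nu np N : ℕ} (d : Data nx nu np N) : Matrix (Fin nx) (Fin N) ℝ :=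
  Matrix.of fun i k => d.x k.succ i

/-- The stacked data matrix `[X; Xᵖ; U; Uᵖ]`. -/
def Data.G {nx nu np N : ℕ} (d : Data nx nu np N) :
    Matrix (Fin nx ⊕ (Fin np × Fin nx) ⊕ Fin nu ⊕ (Fin np × Fin nu)) (Fin N) ℝ :=
  fromRows (Matrix.of fun i k => d.x k.castSucc i)
    (fromRows (Matrix.of fun i k => d.p k.castSucc i.1 * d.x k.castSucc i.2)
      (fromRows (Matrix.of fun i k => d.u k.castSucc i)
        (Matrix.of fun i k => d.p k.castSucc i.1 * d.u k.castSucc i.2)))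

/-- Persistency of excitation: the stacked data matrix has full row rank. -/
def Data.IsPersistentlyExciting {nx nu np N : ℕ} (d : Data nx nu np N) : Prop :=
  d.G.rank = (1 + np) * (nx + nu)

/-! ### The synthesis conditions -/

/-- `F_Q` and `F` represent the same quadratic matrix function of `p` on `ℙ`:
`F [I; p ⊗ I; p ⊗ p ⊗ I] = [I; p ⊗ I]ᵀ F_Q [I; p ⊗ I]`. -/
def SameQuadratic {nx np N : ℕ} (ℙ : Set (Fin np → ℝ))
    (F : Matrix (Fin N) (Fin nx ⊕ (Fin np × Fin nx) ⊕ (Fin np × Fin np × Fin nx)) ℝ)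
    (FQ : Matrix (Fin N ⊕ Fin np × Fin N) (Fin nx ⊕ Fin np × Fin nx) ℝ) : Prop :=
  ∀ p ∈ ℙ, F * regQuad (Fin nx) p = (regAff (Fin N) p)ᵀ * FQ * regAff (Fin nx) p

/-- The block matrix `[P 0 0; 0 I⊗P 0; Y₀ Ybar 0; 0 I⊗Y₀ I⊗Ybar]`. -/
def couplingMatrix {nx nu np : ℕ} (P : Matrix (Fin nx) (Fin nx) ℝ)
    (Y₀ : Matrix (Fin nu) (Fin nx) ℝ) (Ybar : Matrix (Fin nu) (Fin np × Fin nx) ℝ) :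
    Matrix (Fin nx ⊕ (Fin np × Fin nx) ⊕ Fin nu ⊕ (Fin np × Fin nu))
      (Fin nx ⊕ (Fin np × Fin nx) ⊕ (Fin np × Fin np × Fin nx)) ℝ :=
  fromRows (fromCols P (fromCols 0 0))
    (fromRows (fromCols 0 (fromCols ((1 : Matrix (Fin np) (Fin np) ℝ) ⊗ₖ P) 0))
      (fromRows (fromCols Y₀ (fromCols Ybar 0))
        (fromCols 0 (fromCols ((1 : Matrix (Fin np) (Fin np) ℝ) ⊗ₖ Y₀)
          ((1 : Matrix (Fin np) (Fin np) ℝ) ⊗ₖ Ybar)))))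

/-- The matrix `[L₁₁ L₁₂; I 0; L₂₁ L₂₂]`. -/
def sOuter {e d m : Type*} [DecidableEq e]
    (L₁₁ : Matrix e e ℝ) (L₁₂ : Matrix e d ℝ) (L₂₁ : Matrix m e ℝ) (L₂₂ : Matrix m d ℝ) :
    Matrix ((e ⊕ e) ⊕ m) (e ⊕ d) ℝ :=
  fromRows (fromBlocks L₁₁ L₁₂ (1 : Matrix e e ℝ) 0) (fromCols L₂₁ L₂₂)

/-- The full-block S-procedure conditions with multiplier `Ξ` for the matrix `W` and the linear
fractional representation `L(p) = L₂₂ + L₂₁ Δ(p) (I - L₁₁ Δ(p))⁻¹ L₁₂`: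
`(*)ᵀ blkdiag(Ξ, -W) [L₁₁ L₁₂; I 0; L₂₁ L₂₂] ≺ 0` and `(*)ᵀ Ξ [I; Δ(p)] ⪰ 0` for all `p ∈ ℙ`. -/
def SProcedureLMI {np : ℕ} {e d m : Type*} [Fintype e] [DecidableEq e] [Fintype m]
    (ℙ : Set (Fin np → ℝ)) (Δ : (Fin np → ℝ) → Matrix e e ℝ)
    (L₁₁ : Matrix e e ℝ) (L₁₂ : Matrix e d ℝ) (L₂₁ : Matrix m e ℝ) (L₂₂ : Matrix m d ℝ)
    (W : Matrix m m ℝ) (Ξ : Matrix (e ⊕ e) (e ⊕ e) ℝ) : Prop :=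
  (-((sOuter L₁₁ L₁₂ L₂₁ L₂₂)ᵀ * fromBlocks Ξ 0 0 (-W) * sOuter L₁₁ L₁₂ L₂₁ L₂₂)).PosDef ∧
  ∀ p ∈ ℙ, ((fromRows (1 : Matrix e e ℝ) (Δ p))ᵀ * Ξ *
    fromRows (1 : Matrix e e ℝ) (Δ p)).PosSemidef

/-- `Δ(p) = diag(p) ⊗ I_{2nx}`. -/
def Delta (nx : ℕ) {np : ℕ} (p : Fin np → ℝ) :
    Matrix (Fin np × (Fin nx ⊕ Fin nx)) (Fin np × (Fin nx ⊕ Fin nx)) ℝ :=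
  diagonal p ⊗ₖ (1 : Matrix (Fin nx ⊕ Fin nx) (Fin nx ⊕ Fin nx) ℝ)

/-- `L₁₂ = 1_np ⊗ I_{2nx}`. -/
def L12 (nx np : ℕ) : Matrix (Fin np × (Fin nx ⊕ Fin nx)) (Fin nx ⊕ Fin nx) ℝ :=
  colKron (fun _ => 1) 1

/-- `L₂₁ = [0; I_np ⊗ [I 0]; 0; I_np ⊗ [0 I]]`. -/
def L21 (nx np : ℕ) : Matrix ((Fin nx ⊕ Fin np × Fin nx) ⊕ (Fin nx ⊕ Fin np × Fin nx))
    (Fin np × (Fin nx ⊕ Fin nx)) ℝ :=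
  fromRows
    (fromRows 0 ((1 : Matrix (Fin np) (Fin np) ℝ) ⊗ₖ
      fromCols (1 : Matrix (Fin nx) (Fin nx) ℝ) (0 : Matrix (Fin nx) (Fin nx) ℝ)))
    (fromRows 0 ((1 : Matrix (Fin np) (Fin np) ℝ) ⊗ₖ
      fromCols (0 : Matrix (Fin nx) (Fin nx) ℝ) (1 : Matrix (Fin nx) (Fin nx) ℝ)))

/-- `L₂₂ = [[I 0]; 0; [0 I]; 0]`. -/
def L22 (nx np : ℕ) : Matrix ((Fin nx ⊕ Fin np × Fin nx) ⊕ (Fin nx ⊕ Fin np × Fin nx))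
    (Fin nx ⊕ Fin nx) ℝ :=
  fromRows
    (fromRows (fromCols (1 : Matrix (Fin nx) (Fin nx) ℝ) (0 : Matrix (Fin nx) (Fin nx) ℝ)) 0)
    (fromRows (fromCols (0 : Matrix (Fin nx) (Fin nx) ℝ) (1 : Matrix (Fin nx) (Fin nx) ℝ)) 0)

/-- `blkdiag(M, 0)`, with a zero block of size `nx * np`. -/
def pad {nx : ℕ} (np : ℕ) (M : Matrix (Fin nx) (Fin nx) ℝ) :
    Matrix (Fin nx ⊕ Fin np × Fin nx) (Fin nx ⊕ Fin np × Fin nx) ℝ :=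
  fromBlocks M 0 0 0

/-- `blkdiag(X, I_np ⊗ X)`. -/
def blkX {nx N : ℕ} (np : ℕ) (X : Matrix (Fin nx) (Fin N) ℝ) :
    Matrix (Fin nx ⊕ Fin np × Fin nx) (Fin N ⊕ Fin np × Fin N) ℝ :=
  fromBlocks X 0 0 ((1 : Matrix (Fin np) (Fin np) ℝ) ⊗ₖ X)

/-- `W = [P₀ - I_{nx0}, 𝒳₊ F_Q; (𝒳₊ F_Q)ᵀ, P₀]`, `P₀ = blkdiag(P, 0)`,
`I_{nx0} = blkdiag(I, 0)`, `𝒳₊ = blkdiag(X₊, I ⊗ X₊)`. -/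
def W {nx np N : ℕ} (P : Matrix (Fin nx) (Fin nx) ℝ) (X : Matrix (Fin nx) (Fin N) ℝ)
    (FQ : Matrix (Fin N ⊕ Fin np × Fin N) (Fin nx ⊕ Fin np × Fin nx) ℝ) :
    Matrix ((Fin nx ⊕ Fin np × Fin nx) ⊕ (Fin nx ⊕ Fin np × Fin nx))
      ((Fin nx ⊕ Fin np × Fin nx) ⊕ (Fin nx ⊕ Fin np × Fin nx)) ℝ :=
  fromBlocks (pad np P - pad np 1) (blkX np X * FQ) (blkX np X * FQ)ᵀ (pad np P)

/-- The matrix `[S, R^{1/2} [Y₀ Ybar] [I; p ⊗ I]; (*)ᵀ, P]`. -/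
noncomputable def perfLMI {nx nu np : ℕ} (R S : Matrix (Fin nu) (Fin nu) ℝ)
    (P : Matrix (Fin nx) (Fin nx) ℝ) (Y₀ : Matrix (Fin nu) (Fin nx) ℝ)
    (Ybar : Matrix (Fin nu) (Fin np × Fin nx) ℝ) (p : Fin np → ℝ) :
    Matrix (Fin nu ⊕ Fin nx) (Fin nu ⊕ Fin nx) ℝ :=
  fromBlocks S (CFC.sqrt R * fromCols Y₀ Ybar * regAff (Fin nx) p)
    (CFC.sqrt R * fromCols Y₀ Ybar * regAff (Fin nx) p)ᵀ P

/-- The synthesized controller `K(p)`, with `K₀ = Y₀ P⁻¹` and `Kbar = Ybar (I ⊗ P)⁻¹`. -/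
noncomputable def synthGain {nx nu np : ℕ} (P : Matrix (Fin nx) (Fin nx) ℝ)
    (Y₀ : Matrix (Fin nu) (Fin nx) ℝ) (Ybar : Matrix (Fin nu) (Fin np × Fin nx) ℝ) :
    (Fin np → ℝ) → Matrix (Fin nu) (Fin nx) ℝ :=
  gain (Y₀ * P⁻¹) (Ybar * ((1 : Matrix (Fin np) (Fin np) ℝ) ⊗ₖ P)⁻¹)

end LPV

namespace LPV

/-! ### The full-block S-procedure -/

/-! Write `M(p)` for the closed-loop matrix. Everything follows from one inequality, `[P - I, M(p)
P; P M(p)ᵀ, P] ⪰ 0` for `p ∈ ℙ`, used as a quadratic form in a pair `(a, b)`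
(`closedLoop_dissipation`).

The data enter because the state update is linear in `(x, p ⊗ x, u, p ⊗ u)`: `X₊` is the row of all
coefficient matrices times `G`. The coupling equality then turns `X₊ F [I; p ⊗ I; p ⊗ p ⊗ I]` into
`M(p) P`, with `Y(p) = K(p) P` (`closedLoop_mul_eq`). Rewriting this quadratic function of `p`
through `F_Q` makes the block matrix a compression of `W` by `[I; p ⊗ I]`, and the S-procedure
proves it nonnegative.

Two choices of `b` replace Schur complements. One makes `xᵀ P⁻¹ x` contract, the `-I` term supplying
the rate. The other gives `M P Mᵀ + I ⪯ P`, so the covariance recursion `Σ ↦ M Σ Mᵀ + I` started at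
zero stays below `P`. The output power is then at most `tr(C P Cᵀ) ≤ tr(QP) + tr(S) < γ²`. -/

lemma sOuter_mulVec {e d m : Type*} [Fintype e] [DecidableEq e] [Fintype d]
    (L₁₁ : Matrix e e ℝ) (L₁₂ : Matrix e d ℝ) (L₂₁ : Matrix m e ℝ) (L₂₂ : Matrix m d ℝ)
    (q : e → ℝ) (v : d → ℝ) :
    sOuter L₁₁ L₁₂ L₂₁ L₂₂ *ᵥ Sum.elim q v =
      Sum.elim (Sum.elim (L₁₁ *ᵥ q + L₁₂ *ᵥ v) q) (L₂₁ *ᵥ q + L₂₂ *ᵥ v) := by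
  simp [sOuter, fromRows_mulVec, fromBlocks_mulVec]

/-- The full-block S-procedure, for a linear fractional representation that is affine. -/
lemma SProcedureLMI.dotProduct_nonneg {np : ℕ} {e d m : Type*} [Fintype e] [DecidableEq e]
    [Fintype d] [Fintype m] {ℙ : Set (Fin np → ℝ)} {Δ : (Fin np → ℝ) → Matrix e e ℝ}
    {L₁₂ : Matrix e d ℝ} {L₂₁ : Matrix m e ℝ} {L₂₂ : Matrix m d ℝ}
    {V : Matrix m m ℝ} {Ξ : Matrix (e ⊕ e) (e ⊕ e) ℝ}
    (h : SProcedureLMI ℙ Δ 0 L₁₂ L₂₁ L₂₂ V Ξ) {p : Fin np → ℝ} (hp : p ∈ ℙ) (v : d → ℝ) :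
    0 ≤ (L₂₁ *ᵥ (Δ p *ᵥ (L₁₂ *ᵥ v)) + L₂₂ *ᵥ v) ⬝ᵥ
      (V *ᵥ (L₂₁ *ᵥ (Δ p *ᵥ (L₁₂ *ᵥ v)) + L₂₂ *ᵥ v)) := by
  -- With `q = Δ L₁₂ v` and `L₁₁ = 0`, the first two blocks of the outer factor become `[I; Δ] L₁₂
  -- v`, so the `Ξ` term in `h1` is exactly the one bounded below by `h2`.
  have h1 := h.1.posSemidef.dotProduct_mulVec_nonneg (Sum.elim (Δ p *ᵥ (L₁₂ *ᵥ v)) v)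
  have h2 := (h.2 p hp).dotProduct_mulVec_nonneg (L₁₂ *ᵥ v)
  rw [star_trivial, neg_mulVec, dotProduct_neg, ← mulVec_mulVec, ← mulVec_mulVec,
    sOuter_mulVec, dotProduct_mulVec, vecMul_transpose, sOuter_mulVec, fromBlocks_mulVec] at h1
  rw [star_trivial, ← mulVec_mulVec, ← mulVec_mulVec, dotProduct_mulVec, vecMul_transpose,
    fromRows_mulVec, one_mulVec] at h2
  simp only [zero_mulVec, zero_add, add_zero, sumElim_dotProduct_sumElim, Sum.elim_comp_inl,
    Sum.elim_comp_inr, neg_mulVec, dotProduct_neg] at h1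
  linarith

/-- `L₁₂` makes `np` copies of `(a, b)`, `Δ(p)` scales copy `i` by `pᵢ`, and `L₂₁`, `L₂₂` sort the
pieces. -/
lemma lfr_mulVec {nx np : ℕ} (p : Fin np → ℝ) (a b : Fin nx → ℝ) :
    L21 nx np *ᵥ (Delta nx p *ᵥ (L12 nx np *ᵥ Sum.elim a b)) + L22 nx np *ᵥ Sum.elim a b =
      Sum.elim (regAff (Fin nx) p *ᵥ a) (regAff (Fin nx) p *ᵥ b) := by
  have h : Delta nx p *ᵥ (L12 nx np *ᵥ Sum.elim a b) =
      fun i : Fin np × (Fin nx ⊕ Fin nx) => p i.1 * Sum.elim a b i.2 := by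
    ext ⟨i, j⟩
    have : Delta nx p = diagonal fun i => p i.1 := by
      simp [Delta, ← diagonal_one, diagonal_kronecker_diagonal]
    rw [this, mulVec_diagonal]
    simp [L12, colKron, mulVec, dotProduct, one_apply]
  rw [h]
  ext ((i | ⟨i, j⟩) | (i | ⟨i, j⟩)) <;>
  simp [L21, L22, regAff, fromRows_mulVec, colKron, mulVec, dotProduct, one_apply,
    kroneckerMap_apply, Fintype.sum_prod_type]

/-- The mixed-product rule `(pᵀ ⊗ I)(I ⊗ X) = X (pᵀ ⊗ I)`. It exposes the factor around `F_Q` to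
which `SameQuadratic` applies. -/
lemma regAff_transpose_mul_blkX {nx np N : ℕ} (p : Fin np → ℝ) (X : Matrix (Fin nx) (Fin N) ℝ) :
    (regAff (Fin nx) p)ᵀ * blkX np X = X * (regAff (Fin N) p)ᵀ := by
  ext i (j | ⟨j, k⟩) <;>
  simp [regAff, blkX, colKron, mul_apply, one_apply, kroneckerMap_apply, Fintype.sum_prod_type,
    mul_comm]

lemma regAff_transpose_mul_pad_mul_regAff {nx np : ℕ} (p : Fin np → ℝ)
    (M : Matrix (Fin nx) (Fin nx) ℝ) :
    (regAff (Fin nx) p)ᵀ * pad np M * regAff (Fin nx) p = M := by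
  ext i j
  simp [regAff, pad, colKron, mul_apply, one_apply, Fintype.sum_prod_type]

/-! ### Data-based representation of the closed loop -/

/-- The row `[A₀ A₁ ⋯ A_np B₀ B₁ ⋯ B_np]` of all coefficient matrices. -/
def System.coeffs {nx nu np : ℕ} (sys : System nx nu np) :
    Matrix (Fin nx) (Fin nx ⊕ (Fin np × Fin nx) ⊕ Fin nu ⊕ (Fin np × Fin nu)) ℝ :=
  fromCols sys.A₀ (fromCols (Matrix.of fun i j => sys.A' j.1 i j.2)
    (fromCols sys.B₀ (Matrix.of fun i j => sys.B' j.1 i j.2)))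

lemma Data.IsTrajectoryOf.Xplus_eq {nx nu np N : ℕ} {d : Data nx nu np N}
    {sys : System nx nu np} {ℙ : Set (Fin np → ℝ)} (hd : d.IsTrajectoryOf sys ℙ) :
    d.Xplus = sys.coeffs * d.G := by
  ext i k
  rw [mul_apply]
  simp [System.coeffs, Xplus, hd.2 k, G, System.A, System.B, add_mulVec, Matrix.sum_mulVec,
    smul_mulVec, mulVec, dotProduct, Fintype.sum_prod_type, Finset.mul_sum, mul_left_comm,
    add_assoc]

/-- `Y(p) = [Y₀ Ybar] [I; p ⊗ I]` in terms of its blocks. -/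
lemma fromCols_mul_regAff {nx nu np : ℕ} (Y₀ : Matrix (Fin nu) (Fin nx) ℝ)
    (Ybar : Matrix (Fin nu) (Fin np × Fin nx) ℝ) (p : Fin np → ℝ) :
    fromCols Y₀ Ybar * regAff (Fin nx) p = gain Y₀ Ybar p := by
  rw [regAff, fromCols_mul_fromRows, Matrix.mul_one, gain]
  congr 1
  ext i j
  simp [colKron, mul_apply, Fintype.sum_prod_type, one_apply, Matrix.sum_apply, mul_comm]

/-- Since `(I ⊗ P)⁻¹ = I ⊗ P⁻¹`, the inverse acts block by block. This undoes the linearizing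
substitution `Y = K P`. -/
lemma synthGain_mul {nx nu np : ℕ} {P : Matrix (Fin nx) (Fin nx) ℝ} (hP : IsUnit P.det)
    (Y₀ : Matrix (Fin nu) (Fin nx) ℝ) (Ybar : Matrix (Fin nu) (Fin np × Fin nx) ℝ)
    (p : Fin np → ℝ) :
    synthGain P Y₀ Ybar p * P = fromCols Y₀ Ybar * regAff (Fin nx) p := by
  have h : Ybar * ((1 : Matrix (Fin np) (Fin np) ℝ) ⊗ₖ P)⁻¹ =
      Matrix.of fun i j => (Ybar.submatrix id (fun l => (j.1, l)) * P⁻¹) i j.2 := by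
    rw [inv_kronecker, inv_one]
    ext i ⟨j, k⟩
    simp [mul_apply, one_apply, Fintype.sum_prod_type]
  rw [fromCols_mul_regAff, synthGain, gain, gain, h, Matrix.add_mul, Matrix.mul_assoc,
    nonsing_inv_mul _ hP, Matrix.mul_one, Matrix.sum_mul]
  congr 1
  refine Finset.sum_congr rfl fun i _ => ?_
  have : (Matrix.of fun i (j : Fin np × Fin nx) =>
      (Ybar.submatrix id (fun l => (j.1, l)) * P⁻¹) i j.2).submatrix id (fun j => (i, j)) =
      Ybar.submatrix id (fun l => (i, l)) * P⁻¹ := rfl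
  rw [this, Matrix.smul_mul, Matrix.mul_assoc, nonsing_inv_mul _ hP, Matrix.mul_one]

/-- For `Y(p) = K(p) P` these rows are `[I; p ⊗ I; K(p); p ⊗ K(p)] P`, on which the coefficient row
acts as the closed loop. The block `p ⊗ Y(p)` is what requires the degree-two regressor. -/
lemma couplingMatrix_mul_regQuad {nx nu np : ℕ} (P : Matrix (Fin nx) (Fin nx) ℝ)
    (Y₀ : Matrix (Fin nu) (Fin nx) ℝ) (Ybar : Matrix (Fin nu) (Fin np × Fin nx) ℝ)
    (p : Fin np → ℝ) :
    couplingMatrix P Y₀ Ybar * regQuad (Fin nx) p =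
      fromRows P (fromRows (colKron p P) (fromRows (gain Y₀ Ybar p)
        (colKron p (gain Y₀ Ybar p)))) := by
  rw [← fromCols_mul_regAff, regAff, fromCols_mul_fromRows]
  simp only [couplingMatrix, regQuad, fromRows_mul, fromCols_mul_fromRows, Matrix.mul_one,
    Matrix.zero_mul, add_zero, zero_add]
  congr 2
  · ext ⟨i, j⟩ k
    simp [colKron, mul_apply, one_apply, kroneckerMap_apply, Fintype.sum_prod_type, mul_comm]
  · congr 1
    ext ⟨i, j⟩ k
    simp [colKron, mul_apply, one_apply, kroneckerMap_apply, Fintype.sum_prod_type, mul_comm,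
      mul_add, Finset.mul_sum, mul_assoc]

lemma fromCols_mul_colKron {nx np : ℕ} {m n : Type*} (T : Fin np → Matrix m (Fin nx) ℝ)
    (p : Fin np → ℝ) (M : Matrix (Fin nx) n ℝ) :
    (Matrix.of fun i (j : Fin np × Fin nx) => T j.1 i j.2) * colKron p M =
      (∑ i, p i • T i) * M := by
  ext i k
  simp only [colKron, mul_apply, of_apply, Fintype.sum_prod_type, Matrix.sum_apply,
    Finset.sum_mul, Matrix.smul_apply, smul_eq_mul]
  rw [Finset.sum_comm]
  simp [mul_comm, mul_left_comm]

/-- The closed loop, represented by the data. -/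
lemma closedLoop_mul_eq {nx nu np N : ℕ} {ℙ : Set (Fin np → ℝ)} {sys : System nx nu np}
    {d : Data nx nu np N} (hd : d.IsTrajectoryOf sys ℙ)
    {P : Matrix (Fin nx) (Fin nx) ℝ} (hP : IsUnit P.det)
    {F : Matrix (Fin N) (Fin nx ⊕ (Fin np × Fin nx) ⊕ (Fin np × Fin np × Fin nx)) ℝ}
    {Y₀ : Matrix (Fin nu) (Fin nx) ℝ} {Ybar : Matrix (Fin nu) (Fin np × Fin nx) ℝ}
    (hcoupling : couplingMatrix P Y₀ Ybar = d.G * F) (p : Fin np → ℝ) :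
    sys.closedLoop (synthGain P Y₀ Ybar) p * P = d.Xplus * F * regQuad (Fin nx) p := by
  rw [hd.Xplus_eq, Matrix.mul_assoc _ d.G, ← hcoupling, Matrix.mul_assoc,
    couplingMatrix_mul_regQuad, System.coeffs, fromCols_mul_fromRows, fromCols_mul_fromRows,
    fromCols_mul_fromRows, fromCols_mul_colKron, fromCols_mul_colKron, System.closedLoop,
    Matrix.add_mul, Matrix.mul_assoc, synthGain_mul hP, fromCols_mul_regAff, System.A, System.B,
    Matrix.add_mul, Matrix.add_mul, add_assoc]

/-- The dissipation inequality that the S-procedure conditions certify: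
`[P - I, A_CL(p) P; P A_CL(p)ᵀ, P] ⪰ 0` on `ℙ`. -/
lemma closedLoop_dissipation {nx nu np N : ℕ} {ℙ : Set (Fin np → ℝ)} {sys : System nx nu np}
    {d : Data nx nu np N} (hd : d.IsTrajectoryOf sys ℙ)
    {P : Matrix (Fin nx) (Fin nx) ℝ} (hP : IsUnit P.det)
    {Ξ : Matrix ((Fin np × (Fin nx ⊕ Fin nx)) ⊕ (Fin np × (Fin nx ⊕ Fin nx)))
      ((Fin np × (Fin nx ⊕ Fin nx)) ⊕ (Fin np × (Fin nx ⊕ Fin nx))) ℝ}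
    {F : Matrix (Fin N) (Fin nx ⊕ (Fin np × Fin nx) ⊕ (Fin np × Fin np × Fin nx)) ℝ}
    {FQ : Matrix (Fin N ⊕ Fin np × Fin N) (Fin nx ⊕ Fin np × Fin nx) ℝ}
    (hF : SameQuadratic ℙ F FQ)
    {Y₀ : Matrix (Fin nu) (Fin nx) ℝ} {Ybar : Matrix (Fin nu) (Fin np × Fin nx) ℝ}
    (hcoupling : couplingMatrix P Y₀ Ybar = d.G * F)
    (hLMI : SProcedureLMI ℙ (Delta nx) 0 (L12 nx np) (L21 nx np) (L22 nx np)
      (W P d.Xplus FQ) Ξ) {p : Fin np → ℝ} (hp : p ∈ ℙ) (a b : Fin nx → ℝ) :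
    0 ≤ a ⬝ᵥ (P *ᵥ a) - a ⬝ᵥ a
      + 2 * (a ⬝ᵥ (sys.closedLoop (synthGain P Y₀ Ybar) p *ᵥ (P *ᵥ b))) + b ⬝ᵥ (P *ᵥ b) := by
  have key := hLMI.dotProduct_nonneg hp (Sum.elim a b)
  have hpad (M : Matrix (Fin nx) (Fin nx) ℝ) (v : Fin nx → ℝ) :
      (regAff (Fin nx) p *ᵥ v) ⬝ᵥ (pad np M *ᵥ (regAff (Fin nx) p *ᵥ v)) = v ⬝ᵥ (M *ᵥ v) := by
    rw [mulVec_mulVec, ← vecMul_transpose, ← dotProduct_mulVec, mulVec_mulVec,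
      ← Matrix.mul_assoc, regAff_transpose_mul_pad_mul_regAff]
  have hcross : (regAff (Fin nx) p *ᵥ a) ⬝ᵥ
      ((blkX np d.Xplus * FQ) *ᵥ (regAff (Fin nx) p *ᵥ b)) =
      a ⬝ᵥ (sys.closedLoop (synthGain P Y₀ Ybar) p *ᵥ (P *ᵥ b)) := by
    rw [mulVec_mulVec, ← vecMul_transpose, ← dotProduct_mulVec, mulVec_mulVec,
      ← Matrix.mul_assoc, ← Matrix.mul_assoc, regAff_transpose_mul_blkX, mulVec_mulVec,
      closedLoop_mul_eq hd hP hcoupling, Matrix.mul_assoc d.Xplus F, hF p hp,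
      ← Matrix.mul_assoc, ← Matrix.mul_assoc]
  rw [lfr_mulVec, W, fromBlocks_mulVec] at key
  simp only [Sum.elim_comp_inl, Sum.elim_comp_inr, sumElim_dotProduct_sumElim, dotProduct_add,
    sub_mulVec, dotProduct_sub, hpad, hcross, one_mulVec] at key
  -- The transposed off-diagonal block contributes the same scalar, whence the factor 2.
  rw [mulVec_transpose, dotProduct_comm _ (_ ᵥ* _), ← dotProduct_mulVec, hcross] at key
  linarith

/-! ### Stability -/

/-- Entrywise, `|xᵢ xⱼ| ≤ x ⬝ᵥ x`. The added 1 keeps the constant positive, hence invertible, even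
when all entries vanish. -/
lemma dotProduct_mulVec_le {n : Type*} [Fintype n] (P : Matrix n n ℝ) (x : n → ℝ) :
    x ⬝ᵥ (P *ᵥ x) ≤ (1 + ∑ i, ∑ j, |P i j|) * (x ⬝ᵥ x) := by
  have hx (i : n) : x i ^ 2 ≤ x ⬝ᵥ x := by
    simp only [dotProduct, ← sq]
    exact Finset.single_le_sum (f := fun i => x i ^ 2) (fun i _ => sq_nonneg _) (Finset.mem_univ i)
  have h0 : 0 ≤ x ⬝ᵥ x := by simpa using dotProduct_star_self_nonneg x
  have h : x ⬝ᵥ (P *ᵥ x) ≤ (∑ i, ∑ j, |P i j|) * (x ⬝ᵥ x) := by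
    have e : x ⬝ᵥ (P *ᵥ x) = ∑ i, ∑ j, x i * (P i j * x j) :=
      Finset.sum_congr rfl fun i _ => Finset.mul_sum ..
    simp only [e, Finset.sum_mul]
    refine Finset.sum_le_sum fun i _ => Finset.sum_le_sum fun j _ => ?_
    calc x i * (P i j * x j) = P i j * (x i * x j) := by ring
      _ ≤ |P i j| * |x i * x j| := (le_abs_self _).trans (abs_mul _ _).le
      _ ≤ |P i j| * (x ⬝ᵥ x) := by
        refine mul_le_mul_of_nonneg_left (abs_le.2 ⟨?_, ?_⟩) (abs_nonneg _) <;>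
        nlinarith [hx i, hx j, sq_nonneg (x i + x j), sq_nonneg (x i - x j)]
  linarith

lemma norm_toLp_sq {n : Type*} [Fintype n] (x : n → ℝ) : ‖WithLp.toLp 2 x‖ ^ 2 = x ⬝ᵥ x := by
  rw [EuclideanSpace.norm_sq_eq]
  simp [dotProduct, ← sq]

/-- A symmetric `P ⪰ I` with `[P - I, M(p) P; P M(p)ᵀ, P] ⪰ 0` on `ℙ` certifies exponential
stability, with the Lyapunov function `xᵀ P⁻¹ x`. -/
lemma isExponentiallyStable_of_dissipation {nx np : ℕ}
    {M : (Fin np → ℝ) → Matrix (Fin nx) (Fin nx) ℝ} {ℙ : Set (Fin np → ℝ)}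
    {P : Matrix (Fin nx) (Fin nx) ℝ} (hsymm : P.IsSymm) (hdet : IsUnit P.det)
    (hPI : ∀ x, x ⬝ᵥ x ≤ x ⬝ᵥ (P *ᵥ x))
    (h : ∀ p ∈ ℙ, ∀ a b, 0 ≤ a ⬝ᵥ (P *ᵥ a) - a ⬝ᵥ a
      + 2 * (a ⬝ᵥ (M p *ᵥ (P *ᵥ b))) + b ⬝ᵥ (P *ᵥ b)) :
    IsExponentiallyStable M ℙ := by
  set l : ℝ := 1 + ∑ i, ∑ j, |P i j| with hl_def
  have hl : 0 < l := by positivity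
  have hPl (x) : x ⬝ᵥ (P *ᵥ x) ≤ l * (x ⬝ᵥ x) := dotProduct_mulVec_le P x
  have hPinv (x : Fin nx → ℝ) : P *ᵥ (P⁻¹ *ᵥ x) = x := by
    rw [mulVec_mulVec, mul_nonsing_inv _ hdet, one_mulVec]
  have hPcomm (x y : Fin nx → ℝ) : x ⬝ᵥ (P *ᵥ y) = y ⬝ᵥ (P *ᵥ x) := by
    rw [dotProduct_mulVec, ← mulVec_transpose, hsymm.eq, dotProduct_comm]
  have hnn (x : Fin nx → ℝ) : 0 ≤ x ⬝ᵥ x := by simpa using dotProduct_star_self_nonneg x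
  let V (x : Fin nx → ℝ) : ℝ := x ⬝ᵥ (P⁻¹ *ᵥ x)
  -- For `y = P⁻¹ x`, combine `y ⬝ᵥ y ≤ V x` with `0 ≤ ‖y - x‖²`.
  have hupper (x) : V x ≤ x ⬝ᵥ x := by
    have h1 := hPI (P⁻¹ *ᵥ x)
    have h2 := hnn (P⁻¹ *ᵥ x - x)
    rw [hPinv] at h1
    simp only [sub_dotProduct, dotProduct_sub] at h2
    rw [dotProduct_comm _ x] at h1 h2
    simp only [V]
    linarith
  -- The form of `P` at `P⁻¹ x - l⁻¹ x` is nonnegative; expand it and use `P ⪯ l I`.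
  have hlower (x) : x ⬝ᵥ x ≤ l * V x := by
    have h1 := (hnn (P⁻¹ *ᵥ x - l⁻¹ • x)).trans (hPI _)
    have h2 := hPl x
    rw [mulVec_sub, mulVec_smul, hPinv] at h1
    simp only [sub_dotProduct, dotProduct_sub, smul_dotProduct, dotProduct_smul, smul_eq_mul]
      at h1
    rw [hPcomm (P⁻¹ *ᵥ x) x, hPinv, dotProduct_comm _ x] at h1
    have h3 : l⁻¹ * (x ⬝ᵥ (P *ᵥ x)) ≤ x ⬝ᵥ x := by
      rw [inv_mul_le_iff₀ hl]; exact h2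
    have h4 : l⁻¹ * (l⁻¹ * (x ⬝ᵥ (P *ᵥ x))) ≤ l⁻¹ * (x ⬝ᵥ x) :=
      mul_le_mul_of_nonneg_left h3 (inv_nonneg.2 hl.le)
    have h5 : l⁻¹ * (x ⬝ᵥ x) ≤ V x := by simp only [V]; linarith
    rwa [inv_mul_le_iff₀ hl] at h5
  -- For `a = P⁻¹ M x` and `b = -P⁻¹ x` the hypothesis reads `V (M x) + ‖a‖² ≤ V x`, and `P ⪯ l I`
  -- gives `‖a‖² ≥ l⁻¹ V (M x)`.
  have hdecr (p) (hp : p ∈ ℙ) (x) : V (M p *ᵥ x) ≤ (1 + l⁻¹)⁻¹ * V x := by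
    have h1 := h p hp (P⁻¹ *ᵥ (M p *ᵥ x)) (-(P⁻¹ *ᵥ x))
    have h2 := hPl (P⁻¹ *ᵥ (M p *ᵥ x))
    simp only [mulVec_neg, dotProduct_neg, neg_dotProduct, hPinv, neg_neg] at h1 h2
    rw [dotProduct_comm _ (M p *ᵥ x), dotProduct_comm _ x] at h1
    rw [dotProduct_comm _ (M p *ᵥ x)] at h2
    have h3 := (inv_mul_le_iff₀ hl).2 h2
    rw [le_inv_mul_iff₀ (by positivity)]
    simp only [V]
    linarith
  set r : ℝ := (1 + l⁻¹)⁻¹ with hr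
  have hr0 : 0 ≤ r := by positivity
  have hr1 : r < 1 := inv_lt_one_of_one_lt₀ (by linarith [inv_pos.2 hl])
  refine ⟨√l, √r, Real.sqrt_nonneg _, by rwa [Real.sqrt_lt' one_pos, one_pow], ?_⟩
  intro k₀ p x hx n
  have hV : V (x (k₀ + n)) ≤ r ^ n * V (x k₀) := by
    induction n with
    | zero => simp
    | succ n ih =>
      have hs := hx.2 (k₀ + n) (by omega)
      rw [Nat.cast_succ, ← add_assoc, hs, pow_succ', mul_assoc]
      exact (hdecr _ (hx.1 _) _).trans (mul_le_mul_of_nonneg_left ih hr0)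
  refine abs_le_of_sq_le_sq' ?_ (by positivity) |>.2
  rw [mul_pow, mul_pow, ← pow_mul, mul_comm n, pow_mul, Real.sq_sqrt hl.le, Real.sq_sqrt hr0,
    norm_toLp_sq, norm_toLp_sq, mul_assoc]
  exact (hlower _).trans (mul_le_mul_of_nonneg_left
    (hV.trans (mul_le_mul_of_nonneg_left (hupper _) (pow_nonneg hr0 n))) hl.le)

lemma IsExponentiallyStable.isAsymptoticallyStable {nx np : ℕ}
    {M : (Fin np → ℝ) → Matrix (Fin nx) (Fin nx) ℝ} {ℙ : Set (Fin np → ℝ)}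
    (h : IsExponentiallyStable M ℙ) : IsAsymptoticallyStable M ℙ := by
  obtain ⟨C, ρ, hρ0, hρ1, h⟩ := h
  -- The sign of `C` is not prescribed, so `|C| + 1` serves as a positive bound.
  refine ⟨fun ε hε => ⟨ε / (|C| + 1), by positivity, fun k₀ p x hx hδ k hk => ?_⟩,
    fun k₀ p x hx => ?_⟩
  · obtain ⟨n, rfl⟩ := Int.le.dest hk
    rw [lt_div_iff₀ (by positivity)] at hδ
    have hρn : ρ ^ n ≤ 1 := pow_le_one₀ hρ0 hρ1.le
    have hCρ : C * ρ ^ n ≤ |C| + 1 :=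
      calc C * ρ ^ n ≤ |C| * ρ ^ n := mul_le_mul_of_nonneg_right (le_abs_self C) (by positivity)
        _ ≤ |C| * 1 := mul_le_mul_of_nonneg_left hρn (abs_nonneg C)
        _ ≤ |C| + 1 := by linarith
    calc ‖WithLp.toLp 2 (x (k₀ + n))‖ ≤ C * ρ ^ n * ‖WithLp.toLp 2 (x k₀)‖ := h k₀ p x hx n
      _ ≤ (|C| + 1) * ‖WithLp.toLp 2 (x k₀)‖ :=
        mul_le_mul_of_nonneg_right hCρ (norm_nonneg _)
      _ < ε := by linarith
  · have h1 : Tendsto (fun n : ℕ => C * ρ ^ n * ‖WithLp.toLp 2 (x k₀)‖) atTop (𝓝 0) := by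
      simpa using ((tendsto_pow_atTop_nhds_zero_of_lt_one hρ0 hρ1).const_mul C).mul_const
        ‖WithLp.toLp 2 (x k₀)‖
    have h2 : Tendsto (fun n : ℕ => WithLp.toLp 2 (x (k₀ + n))) atTop (𝓝 0) :=
      squeeze_zero_norm (h k₀ p x hx) h1
    have h3 : Tendsto (fun n : ℕ => x (k₀ + n)) atTop (𝓝 0) :=
      ((PiLp.continuous_ofLp 2 fun _ : Fin nx => ℝ).tendsto 0).comp h2
    -- Passes from the decay in `n : ℕ` to convergence in integer time.
    have h4 : Tendsto (fun k : ℤ => (k - k₀).toNat) atTop atTop :=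
      tendsto_atTop.2 fun b => (eventually_ge_atTop (k₀ + b)).mono fun k hk => by omega
    refine (h3.comp h4).congr' ?_
    filter_upwards [eventually_ge_atTop k₀] with k hk
    simp [Int.toNat_of_nonneg (sub_nonneg.2 hk)]

/-! ### The generalized `H₂` norm -/

/-- Testing against a vector moves `M` onto that vector, so moments of the state reduce to scalar
ones; the inductions below therefore vary `a`. -/
lemma dotProduct_noisyState_succ {Ω : Type*} {nx np : ℕ} (M : (Fin np → ℝ) → Matrix (Fin nx) (Fin nx) ℝ)
    (p : ℤ → Fin np → ℝ) (w : ℕ → Ω → Fin nx → ℝ) (a : Fin nx → ℝ) (k : ℕ) (ω : Ω) :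
    a ⬝ᵥ noisyState M p w (k + 1) ω =
      ((M (p k))ᵀ *ᵥ a) ⬝ᵥ noisyState M p w k ω + a ⬝ᵥ w k ω := by
  rw [noisyState, dotProduct_add, dotProduct_mulVec, mulVec_transpose]

section Noise

variable {Ω : Type*} [MeasurableSpace Ω] {μ : Measure Ω}

lemma IsWhiteNoise.memLp_dotProduct {n : ℕ} {w : ℕ → Ω → Fin n → ℝ} (hw : IsWhiteNoise μ w)
    (a : Fin n → ℝ) (k : ℕ) : MemLp (fun ω => a ⬝ᵥ w k ω) 2 μ :=
  memLp_finsetSum _ fun i _ => (hw.memLp k i).const_mul (a i)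

lemma IsWhiteNoise.integral_dotProduct_mul {n : ℕ} {w : ℕ → Ω → Fin n → ℝ}
    (hw : IsWhiteNoise μ w) (a b : Fin n → ℝ) (k l : ℕ) :
    ∫ ω, (a ⬝ᵥ w k ω) * (b ⬝ᵥ w l ω) ∂μ = if k = l then a ⬝ᵥ b else 0 := by
  have hint (i j) : Integrable (fun ω => a i * w k ω i * (b j * w l ω j)) μ :=
    MemLp.integrable_mul ((hw.memLp k i).const_mul (a i)) ((hw.memLp l j).const_mul (b j))
  have e (i j ω) : a i * w k ω i * (b j * w l ω j) = a i * b j * (w k ω i * w l ω j) :=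
    mul_mul_mul_comm ..
  simp only [dotProduct, Finset.sum_mul_sum]
  rw [integral_finsetSum _ fun i _ => integrable_finsetSum _ fun j _ => hint i j]
  simp_rw [integral_finsetSum _ fun j _ => hint _ j, e, integral_const_mul, hw.cov]
  by_cases h : k = l <;> simp [h]

lemma IsWhiteNoise.memLp_dotProduct_noisyState {nx np : ℕ} {w : ℕ → Ω → Fin nx → ℝ}
    (hw : IsWhiteNoise μ w) (M : (Fin np → ℝ) → Matrix (Fin nx) (Fin nx) ℝ)
    (p : ℤ → Fin np → ℝ) (k : ℕ) (a : Fin nx → ℝ) :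
    MemLp (fun ω => a ⬝ᵥ noisyState M p w k ω) 2 μ := by
  induction k generalizing a with
  | zero => simp [noisyState, ← Pi.zero_def]
  | succ k ih =>
    simp_rw [dotProduct_noisyState_succ]
    exact (ih _).add (hw.memLp_dotProduct a k)

/-- The state at time `k` involves only noise before `k`. The case `k = l` is the one the covariance
recursion needs. -/
lemma IsWhiteNoise.integral_noisyState_mul {nx np : ℕ} {w : ℕ → Ω → Fin nx → ℝ}
    (hw : IsWhiteNoise μ w) (M : (Fin np → ℝ) → Matrix (Fin nx) (Fin nx) ℝ)
    (p : ℤ → Fin np → ℝ) {k l : ℕ} (hkl : k ≤ l) (a b : Fin nx → ℝ) :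
    ∫ ω, (a ⬝ᵥ noisyState M p w k ω) * (b ⬝ᵥ w l ω) ∂μ = 0 := by
  induction k generalizing a with
  | zero => simp [noisyState]
  | succ k ih =>
    simp_rw [dotProduct_noisyState_succ, add_mul]
    rw [integral_add, ih (by omega), hw.integral_dotProduct_mul, if_neg (by omega), add_zero]
    · exact (hw.memLp_dotProduct_noisyState M p k _).integrable_mul (hw.memLp_dotProduct b l)
    · exact (hw.memLp_dotProduct a k).integrable_mul (hw.memLp_dotProduct b l)

/-- If `M(p) P M(p)ᵀ + I ⪯ P` on `ℙ`, then the covariance of the state is at most `P`. -/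
lemma IsWhiteNoise.integral_noisyState_sq_le {nx np : ℕ} {w : ℕ → Ω → Fin nx → ℝ}
    (hw : IsWhiteNoise μ w) {M : (Fin np → ℝ) → Matrix (Fin nx) (Fin nx) ℝ}
    {ℙ : Set (Fin np → ℝ)} {P : Matrix (Fin nx) (Fin nx) ℝ} (hP : ∀ a, 0 ≤ a ⬝ᵥ (P *ᵥ a))
    (h : ∀ p ∈ ℙ, ∀ a, ((M p)ᵀ *ᵥ a) ⬝ᵥ (P *ᵥ ((M p)ᵀ *ᵥ a)) + a ⬝ᵥ a ≤ a ⬝ᵥ (P *ᵥ a))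
    {p : ℤ → Fin np → ℝ} (hp : ∀ k, p k ∈ ℙ) (k : ℕ) (a : Fin nx → ℝ) :
    ∫ ω, (a ⬝ᵥ noisyState M p w k ω) ^ 2 ∂μ ≤ a ⬝ᵥ (P *ᵥ a) := by
  induction k generalizing a with
  | zero => simpa [noisyState] using hP a
  | succ k ih =>
    refine le_trans ?_ (h (p k) (hp k) a)
    set b := (M (p k))ᵀ *ᵥ a
    have hx := hw.memLp_dotProduct_noisyState M p k b
    have hn := hw.memLp_dotProduct a k
    -- On integrating, the cross term vanishes, the last term gives `a ⬝ᵥ a`, and the first is the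
    -- induction hypothesis at `b`.
    have e (ω) : (a ⬝ᵥ noisyState M p w (k + 1) ω) ^ 2 = (b ⬝ᵥ noisyState M p w k ω) ^ 2
        + 2 * ((b ⬝ᵥ noisyState M p w k ω) * (a ⬝ᵥ w k ω))
        + (a ⬝ᵥ w k ω) * (a ⬝ᵥ w k ω) := by
      rw [dotProduct_noisyState_succ]; ring
    have hxn : Integrable
        (fun ω => 2 * ((b ⬝ᵥ noisyState M p w k ω) * (a ⬝ᵥ w k ω))) μ :=
      (hx.integrable_mul hn).const_mul 2
    simp_rw [e]
    have hnn : Integrable (fun ω => (a ⬝ᵥ w k ω) * (a ⬝ᵥ w k ω)) μ := hn.integrable_mul hn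
    have hsum : Integrable (fun ω => (b ⬝ᵥ noisyState M p w k ω) ^ 2
        + 2 * ((b ⬝ᵥ noisyState M p w k ω) * (a ⬝ᵥ w k ω))) μ := hx.integrable_sq.add hxn
    rw [integral_add hsum hnn, integral_add hx.integrable_sq hxn, integral_const_mul,
      hw.integral_noisyState_mul M p le_rfl, hw.integral_dotProduct_mul, if_pos rfl]
    linarith [ih b]

/-- If the state covariance is at most `P` and `tr(C(p) P C(p)ᵀ) ≤ β` on `ℙ`, then the
generalized `H₂` norm is at most `√β`. -/
lemma IsWhiteNoise.genH2Norm_le {nx np : ℕ} {nz : Type*} [Fintype nz] {w : ℕ → Ω → Fin nx → ℝ}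
    (hw : IsWhiteNoise μ w) {M : (Fin np → ℝ) → Matrix (Fin nx) (Fin nx) ℝ}
    {C : (Fin np → ℝ) → Matrix nz (Fin nx) ℝ}
    {ℙ : Set (Fin np → ℝ)} {P : Matrix (Fin nx) (Fin nx) ℝ} (hP : ∀ a, 0 ≤ a ⬝ᵥ (P *ᵥ a))
    (h : ∀ p ∈ ℙ, ∀ a, ((M p)ᵀ *ᵥ a) ⬝ᵥ (P *ᵥ ((M p)ᵀ *ᵥ a)) + a ⬝ᵥ a ≤ a ⬝ᵥ (P *ᵥ a))
    {β : ℝ} (hC : ∀ p ∈ ℙ, ∑ i, C p i ⬝ᵥ (P *ᵥ C p i) ≤ β) :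
    genH2Norm μ M C ℙ w ≤ ENNReal.ofReal β ^ (1 / 2 : ℝ) := by
  refine iSup₂_le fun p hp => ENNReal.rpow_le_rpow ?_ (by norm_num)
  have hint (k : ℕ) : Integrable (fun ω => (C (p k) *ᵥ noisyState M p w k ω) ⬝ᵥ
      (C (p k) *ᵥ noisyState M p w k ω)) μ := integrable_finsetSum _ fun i _ =>
    (hw.memLp_dotProduct_noisyState M p k (C (p k) i)).integrable_mul
      (hw.memLp_dotProduct_noisyState M p k (C (p k) i))
  have hle (k : ℕ) : ∫ ω, (C (p k) *ᵥ noisyState M p w k ω) ⬝ᵥ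
      (C (p k) *ᵥ noisyState M p w k ω) ∂μ ≤ β := by
    refine le_trans ?_ (hC (p k) (hp k))
    have e (ω) : (C (p k) *ᵥ noisyState M p w k ω) ⬝ᵥ (C (p k) *ᵥ noisyState M p w k ω) =
        ∑ i, (C (p k) i ⬝ᵥ noisyState M p w k ω) ^ 2 := by
      simp only [sq]; rfl
    simp_rw [e]
    rw [integral_finsetSum _ fun i _ =>
      (hw.memLp_dotProduct_noisyState M p k (C (p k) i)).integrable_sq]
    exact Finset.sum_le_sum fun i _ => hw.integral_noisyState_sq_le hP h hp k _
  -- There are `N + 1` terms but the weight is `1 / N`; the excess factor tends to 1. At `N = 0`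
  -- both sides are zero because `1 / 0 = 0`.
  have hbound (N : ℕ) : ∫⁻ ω, ENNReal.ofReal ((1 / (N : ℝ)) * ∑ k ∈ Finset.range (N + 1),
      (C (p k) *ᵥ noisyState M p w k ω) ⬝ᵥ (C (p k) *ᵥ noisyState M p w k ω)) ∂μ ≤
      ENNReal.ofReal ((1 / (N : ℝ)) * ((N + 1) * β)) := by
    rw [← ofReal_integral_eq_lintegral_ofReal
      ((integrable_finsetSum _ fun k _ => hint k).const_mul _)
      (ae_of_all _ fun ω => mul_nonneg (by positivity) (Finset.sum_nonneg fun k _ => by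
        simpa using dotProduct_star_self_nonneg (C (p k) *ᵥ noisyState M p w k ω)))]
    refine ENNReal.ofReal_le_ofReal ?_
    rw [integral_const_mul, integral_finsetSum _ fun k _ => hint k]
    refine mul_le_mul_of_nonneg_left ?_ (by positivity)
    exact (Finset.sum_le_card_nsmul _ _ β fun k _ => hle k).trans_eq (by simp)
  have hlim : Tendsto (fun N : ℕ => ENNReal.ofReal ((1 / (N : ℝ)) * ((N + 1) * β))) atTop
      (𝓝 (ENNReal.ofReal β)) := by
    refine ENNReal.tendsto_ofReal ?_
    have h1 : Tendsto (fun N : ℕ => β + 1 / (N : ℝ) * β) atTop (𝓝 β) := by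
      simpa using (tendsto_one_div_atTop_nhds_zero_nat (𝕜 := ℝ)).mul_const β |>.const_add β
    refine h1.congr' ?_
    filter_upwards [eventually_gt_atTop 0] with N hN
    have : (N : ℝ) ≠ 0 := by exact_mod_cast hN.ne'
    field_simp
  exact (limsup_le_limsup (Eventually.of_forall hbound)).trans hlim.limsup_eq.le

end Noise

/-- The performance of the closed loop, `tr(C(p) P C(p)ᵀ) ≤ tr(QP) + tr(S)`. -/
lemma sum_perfMatrix_le {nx nu np : ℕ} {Q : Matrix (Fin nx) (Fin nx) ℝ} (hQ : Q.PosSemidef)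
    {R S : Matrix (Fin nu) (Fin nu) ℝ} {P : Matrix (Fin nx) (Fin nx) ℝ}
    {Y₀ : Matrix (Fin nu) (Fin nx) ℝ} {Ybar : Matrix (Fin nu) (Fin np × Fin nx) ℝ}
    {p : Fin np → ℝ} {K : (Fin np → ℝ) → Matrix (Fin nu) (Fin nx) ℝ}
    (hK : K p * P = fromCols Y₀ Ybar * regAff (Fin nx) p)
    (h : (perfLMI R S P Y₀ Ybar p).PosSemidef) :
    ∑ i, perfMatrix Q R K p i ⬝ᵥ (P *ᵥ perfMatrix Q R K p i) ≤ (Q * P).trace + S.trace := by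
  rw [Fintype.sum_sum_type]
  refine add_le_add (le_of_eq ?_) (Finset.sum_le_sum fun i _ => ?_)
  · have hs : (CFC.sqrt Q)ᵀ = CFC.sqrt Q := by
      simpa using (Matrix.nonneg_iff_posSemidef.1 (CFC.sqrt_nonneg Q)).isHermitian.eq
    calc ∑ i, perfMatrix Q R K p (Sum.inl i) ⬝ᵥ (P *ᵥ perfMatrix Q R K p (Sum.inl i))
        = (CFC.sqrt Q * P * (CFC.sqrt Q)ᵀ).trace := by
          refine Finset.sum_congr rfl fun i _ => ?_
          rw [Matrix.diag_apply, Matrix.mul_assoc]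
          rfl
      _ = (Q * P).trace := by
          rw [hs, Matrix.trace_mul_comm, ← Matrix.mul_assoc,
            CFC.sqrt_mul_sqrt_self Q (Matrix.nonneg_iff_posSemidef.2 hQ)]
  · set g : Fin nx → ℝ := perfMatrix Q R K p (Sum.inr i) with hg
    have hg' : g = Pi.single i 1 ᵥ* (CFC.sqrt R * K p) := by
      rw [single_one_vecMul]; rfl
    have hrow : Pi.single i 1 ⬝ᵥ
        ((CFC.sqrt R * fromCols Y₀ Ybar * regAff (Fin nx) p) *ᵥ g) = g ⬝ᵥ (P *ᵥ g) := by
      rw [Matrix.mul_assoc, ← hK, ← Matrix.mul_assoc, ← mulVec_mulVec, dotProduct_mulVec, ← hg']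
    -- With `g` row `i` of `R^{1/2} K(p)`, this vector gives `S i i - 2 gᵀPg + gᵀPg ≥ 0`: a Schur
    -- complement bound without inverting `P`.
    have h1 := h.dotProduct_mulVec_nonneg (Sum.elim (Pi.single i 1) (-g))
    rw [star_trivial, perfLMI, fromBlocks_mulVec] at h1
    simp only [Sum.elim_comp_inl, Sum.elim_comp_inr, sumElim_dotProduct_sumElim, dotProduct_add,
      mulVec_neg, dotProduct_neg, neg_dotProduct, neg_neg, hrow] at h1
    rw [mulVec_transpose, dotProduct_comm g (_ ᵥ* _), ← dotProduct_mulVec, hrow] at h1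
    simp only [mulVec_single_one, single_one_dotProduct, col_apply] at h1
    rw [Matrix.diag_apply]
    linarith

end LPV

theorem theorem5 {nx nu np N : ℕ}
    -- the scheduling set and the system
    (ℙ : Set (Fin np → ℝ)) (hℙ : IsCompact ℙ) (hℙc : Convex ℝ ℙ)
    (sys : LPV.System nx nu np)
    -- the data, measured from the system and persistently exciting
    (d : LPV.Data nx nu np N) (hd : d.IsTrajectoryOf sys ℙ) (hPE : d.IsPersistentlyExciting)
    -- the tuning matrices and the performance objective
    (Q : Matrix (Fin nx) (Fin nx) ℝ) (hQ : Q.PosSemidef)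
    (R : Matrix (Fin nu) (Fin nu) ℝ) (hR : R.PosDef)
    (γ : ℝ) (hγ : 0 < γ)
    -- the decision variables
    (P : Matrix (Fin nx) (Fin nx) ℝ) (hP : P.IsSymm)
    (S : Matrix (Fin nu) (Fin nu) ℝ) (hS : S.IsSymm)
    (Ξ : Matrix ((Fin np × (Fin nx ⊕ Fin nx)) ⊕ (Fin np × (Fin nx ⊕ Fin nx)))
      ((Fin np × (Fin nx ⊕ Fin nx)) ⊕ (Fin np × (Fin nx ⊕ Fin nx))) ℝ) (hΞ : Ξ.IsSymm)
    (F : Matrix (Fin N) (Fin nx ⊕ (Fin np × Fin nx) ⊕ (Fin np × Fin np × Fin nx)) ℝ)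
    (FQ : Matrix (Fin N ⊕ Fin np × Fin N) (Fin nx ⊕ Fin np × Fin nx) ℝ)
    (hF : LPV.SameQuadratic ℙ F FQ)
    (Y₀ : Matrix (Fin nu) (Fin nx) ℝ) (Ybar : Matrix (Fin nu) (Fin np × Fin nx) ℝ)
    -- the synthesis conditions
    (hcoupling : LPV.couplingMatrix P Y₀ Ybar = d.G * F)
    (hLMI : LPV.SProcedureLMI ℙ (LPV.Delta nx) 0 (LPV.L12 nx np) (LPV.L21 nx np) (LPV.L22 nx np)
      (LPV.W P d.Xplus FQ) Ξ)
    (hperf : ∀ p ∈ ℙ, (LPV.perfLMI R S P Y₀ Ybar p).PosDef)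
    (hPI : (P - 1).PosDef)
    (htrace : (Q * P).trace + S.trace < γ ^ 2) :
    -- the closed loop is stable
    LPV.IsAsymptoticallyStable (sys.closedLoop (LPV.synthGain P Y₀ Ybar)) ℙ ∧
    LPV.IsExponentiallyStable (sys.closedLoop (LPV.synthGain P Y₀ Ybar)) ℙ ∧
    -- the generalized `H₂` norm of the closed-loop generalized plant is less than `γ`
    ∀ (Ω : Type v) [MeasurableSpace Ω] (μ : MeasureTheory.Measure Ω)
      [MeasureTheory.IsProbabilityMeasure μ] (w : ℕ → Ω → Fin nx → ℝ), LPV.IsWhiteNoise μ w →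
      LPV.genH2Norm μ (sys.closedLoop (LPV.synthGain P Y₀ Ybar))
        (LPV.perfMatrix Q R (LPV.synthGain P Y₀ Ybar)) ℙ w < ENNReal.ofReal γ := by
  have hsymm (a b : Fin nx → ℝ) : a ⬝ᵥ (P *ᵥ b) = b ⬝ᵥ (P *ᵥ a) := by
    rw [dotProduct_mulVec, ← mulVec_transpose, hP.eq, dotProduct_comm]
  have hnn (a : Fin nx → ℝ) : 0 ≤ a ⬝ᵥ a := by simpa using dotProduct_star_self_nonneg a
  have hPI' (a : Fin nx → ℝ) : a ⬝ᵥ a ≤ a ⬝ᵥ (P *ᵥ a) := by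
    have := hPI.posSemidef.dotProduct_mulVec_nonneg a
    rw [star_trivial, sub_mulVec, one_mulVec, dotProduct_sub] at this
    linarith
  have hdet : IsUnit P.det := by
    have h : (P - 1 + 1).PosDef := hPI.add PosDef.one
    rw [sub_add_cancel] at h
    exact h.det_pos.ne'.isUnit
  have hdiss (p) (hp : p ∈ ℙ) (a b : Fin nx → ℝ) :=
    LPV.closedLoop_dissipation hd hdet hF hcoupling hLMI hp a b
  have hexp := LPV.isExponentiallyStable_of_dissipation hP hdet hPI' hdiss
  refine ⟨hexp.isAsymptoticallyStable, hexp, fun Ω _ μ _ w hw => ?_⟩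
  have hnorm := hw.genH2Norm_le (β := (Q * P).trace + S.trace) (fun a => (hnn a).trans (hPI' a))
    (fun p hp a => by
      set M := sys.closedLoop (LPV.synthGain P Y₀ Ybar) p with hM
      -- This `b` cancels one of the two copies of `a ⬝ᵥ M P Mᵀ a`, leaving `M P Mᵀ + I ⪯ P`.
      have h := hdiss p hp a (-(Mᵀ *ᵥ a))
      simp only [← hM, mulVec_neg, dotProduct_neg, neg_dotProduct, neg_neg] at h
      rw [dotProduct_mulVec a M, ← mulVec_transpose] at h
      linarith)
    (fun p hp => LPV.sum_perfMatrix_le hQ (LPV.synthGain_mul hdet Y₀ Ybar p)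
      (hperf p hp).posSemidef)
  refine hnorm.trans_lt ?_
  -- The strict inequality comes from the trace condition alone; the bound on the norm is uniform
  -- over the scheduling, so the supremum preserves it.
  calc ENNReal.ofReal ((Q * P).trace + S.trace) ^ (1 / 2 : ℝ)
      < ENNReal.ofReal (γ ^ 2) ^ (1 / 2 : ℝ) :=
        ENNReal.rpow_lt_rpow ((ENNReal.ofReal_lt_ofReal_iff (by positivity)).2 htrace)
          (by norm_num)
    _ = ENNReal.ofReal γ := by
        rw [ENNReal.ofReal_rpow_of_nonneg (by positivity) (by norm_num), ← Real.sqrt_eq_rpow,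
          Real.sqrt_sq hγ.le]
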